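/- Let $(\mathcal V,\otimes,\mathbf 1)$ be a monoidal category that is closed (every functor $A\otimes-$ has a right adjoint) and locally presentable. A family of morphisms $(\beta_i:B\to B_i)_{i\in I}$ is called jointly monic if $f=g$ whenever $f,g:Z\to B$ satisfy $\beta_i f=\beta_i g$ for all $i\in I$. Assume that the monoidal product is very flat: for every object $A$ and every jointly monic family $(\beta_i:B\to B_i)_{i\in I}$ indexed by a non-empty set $I$, the families $(\beta_i\otimes \mathrm{id}_A:B\otimes A\to B_i\otimes A)_{i\in I}$ and $(\mathrm{id}_A\otimes\beta_i:A\otimes B\to A\otimes B_i)_{i\in I}$ are again jointly monic. Let $\mathsf{Coalg}(\mathcal V)$ be the category of (coassociative, counital) coalgebras in $\mathcal V$. Then the forgetful functor $\mathsf{Coalg}(\mathcal V)\to\mathcal V$ has a right adjoint $T^c$ (the cofree coalgebra functor), and the following hold. 1. If $\mathcal V$ carries a symmetry $\sigma$ for its monoidal structure, then for every $V$ in $\mathcal V$ there is an isomorphism of coalgebras $t_V:T^c(V)\to T^c(V)^{cop}$, natural in $V$ and involutive, i.e. $t_V\circ t_V=\mathrm{id}$ as morphisms of $\mathcal V$. Here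 $C^{cop}$ denotes, for a coalgebra $(C,\Delta,\epsilon)$, the coalgebra $(C,\sigma_{C,C}\circ\Delta,\epsilon)$. 2. For a category $\mathcal W$, let $\mathcal W\text{-}\mathsf{Grph}$ be the category whose objects are pairs $(A^0,(A_{x,y})_{x,y\in A^0})$ of a set $A^0$ and a family of objects of $\mathcal W$, and whose morphisms $A\to B$ are pairs of a map $f:A^0\to B^0$ and a family of morphisms $A_{x,y}\to B_{f(x),f(y)}$ in $\mathcal W$. The forgetful functor $\mathsf{Coalg}(\mathcal V)\text{-}\mathsf{Grph}\to\mathcal V\text{-}\mathsf{Grph}$, which keeps the set of objects and applies $\mathsf{Coalg}(\mathcal V)\to\mathcal V$ to all Hom-objects, has a right adjoint. -/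

import Mathlib

open CategoryTheory MonoidalCategory ComonObj

universe w v u v' u'

/-- A family of morphisms `β i : B ⟶ Bᵢ` with common domain is jointly monic if two parallel
morphisms into `B` agree as soon as all their composites with the `β i` agree. -/
def JointlyMonic {V : Type u} [Category.{v} V] {ι : Type w} {B : V} {Bi : ι → V}
    (β : ∀ i, B ⟶ Bi i) : Prop :=
  ∀ ⦃Z : V⦄ (f g : Z ⟶ B), (∀ i, f ≫ β i = g ≫ β i) → f = g

/-- `V` has a very flat monoidal product: for every object `A`, both endofunctors `- ⊗ A` and
`A ⊗ -` preserve jointly monic families indexed by arbitrary nonempty (small) sets.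
The empty family is left out: it is jointly monic on `B` only if `B` is subterminal, and already
for the cartesian category of sets it is not preserved by the functors `- × A`. -/
class VeryFlatTensor (V : Type u) [Category.{v} V] [MonoidalCategory V] : Prop where
  whiskerRight : ∀ (A : V) {ι : Type v} [Nonempty ι] {B : V} {Bi : ι → V} (β : ∀ i, B ⟶ Bi i),
    JointlyMonic β → JointlyMonic (fun i => β i ▷ A)
  whiskerLeft : ∀ (A : V) {ι : Type v} [Nonempty ι] {B : V} {Bi : ι → V} (β : ∀ i, B ⟶ Bi i),
    JointlyMonic β → JointlyMonic (fun i => A ◁ β i)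

/-- A `V`-graph: a set `A⁰` of objects and a family `A_{x,y}` of objects of `V` indexed by
`A⁰ × A⁰`. -/
structure VGraph (V : Type u) where
  obj : Type w
  hom : obj → obj → V

namespace VGraph

/-- A morphism of `V`-graphs: a map `f⁰ : A⁰ → B⁰` together with morphisms
`A_{x,y} ⟶ B_{f x, f y}` in `V`. -/
@[ext]
structure Hom {V : Type u} [Category.{v} V] (A B : VGraph.{w} V) where
  onObj : A.obj → B.obj
  onHom : ∀ x y : A.obj, A.hom x y ⟶ B.hom (onObj x) (onObj y)

/-- The category of `V`-graphs. -/
instance {V : Type u} [Category.{v} V] : Category (VGraph.{w} V) where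
  Hom A B := Hom A B
  id A := ⟨fun x => x, fun x y => 𝟙 (A.hom x y)⟩
  comp f g := ⟨fun x => g.onObj (f.onObj x),
    fun x y => f.onHom x y ≫ g.onHom (f.onObj x) (f.onObj y)⟩
  id_comp f := by
    apply Hom.ext
    · rfl
    · simp
  comp_id f := by
    apply Hom.ext
    · rfl
    · simp
  assoc f g h := by
    apply Hom.ext
    · rfl
    · simp

/-- The functor on graphs induced componentwise by a functor `F : V ⥤ W`; it does not change the
sets of objects. -/
def mapFunctor {V : Type u} [Category.{v} V] {W : Type u'} [Category.{v'} W] (F : V ⥤ W) :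
    VGraph.{w} V ⥤ VGraph.{w} W where
  obj A := ⟨A.obj, fun x y => F.obj (A.hom x y)⟩
  map f := ⟨f.onObj, fun x y => F.map (f.onHom x y)⟩
  map_id A := by
    apply Hom.ext
    · rfl
    · apply heq_of_eq
      funext x y
      exact F.map_id _
  map_comp f g := by
    apply Hom.ext
    · rfl
    · apply heq_of_eq
      funext x y
      exact F.map_comp _ _

end VGraph

/-- The co-opposite of a coalgebra: the same underlying object and counit, and the
comultiplication followed by the symmetry. -/
def copObj {V : Type u} [Category.{v} V] [MonoidalCategory V] [BraidedCategory V]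
    (C : Comon V) : Comon V where
  X := C.X
  comon :=
    { counit := ε[C.X]
      comul := Δ[C.X] ≫ (β_ C.X C.X).hom
      counit_comul := by
        rw [Category.assoc, ← BraidedCategory.braiding_naturality_right, comul_counit_assoc]
        simp
      comul_counit := by
        rw [Category.assoc, ← BraidedCategory.braiding_naturality_left, counit_comul_assoc]
        simp
      comul_assoc := by
        simp only [Category.assoc, MonoidalCategory.whiskerLeft_comp, comp_whiskerRight]
        rw [← BraidedCategory.braiding_naturality_left_assoc,
          ← BraidedCategory.braiding_naturality_right_assoc, comul_assoc_assoc]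
        simp only [BraidedCategory.braiding_tensor_left_hom,
          BraidedCategory.braiding_tensor_right_hom, Category.assoc, Iso.hom_inv_id_assoc]
        simpa using congrArg (fun k : C.X ⊗ C.X ⊗ C.X ⟶ C.X ⊗ C.X ⊗ C.X =>
          Δ[C.X] ≫ Δ[C.X] ▷ C.X ≫ (α_ C.X C.X C.X).hom ≫ k)
          (BraidedCategory.yang_baxter C.X C.X C.X).symm }

/-- The functor `C ↦ C^cop` on coalgebras; it does not change underlying morphisms. -/
def cop (V : Type u) [Category.{v} V] [MonoidalCategory V] [BraidedCategory V] :
    Comon V ⥤ Comon V where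
  obj C := copObj C
  map {C D} f :=
    { hom := (f.hom : C.X ⟶ D.X)
      isComonHom_hom :=
        { hom_counit := IsComonHom.hom_counit f.hom
          hom_comul := by
            change f.hom ≫ Δ[D.X] ≫ (β_ D.X D.X).hom =
              (Δ[C.X] ≫ (β_ C.X C.X).hom) ≫ (f.hom ⊗ₘ f.hom)
            rw [IsComonHom.hom_comul_assoc, Category.assoc, BraidedCategory.braiding_naturality] } }
  map_id _ := rfl
  map_comp _ _ := rfl

/-! The cofree coalgebra on `X` is a terminal object among coalgebras over `X`. Iterated
comultiplication sends a coalgebra over `X` to every tensor power of `X`, hence to their product.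
Take the image `D` of this map. Very flatness makes `D ⊗ D` a subobject of the product of all `tpow
X n ⊗ tpow X m`, so the comultiplication descends to `D` by a diagonal fill-in
(`exists_comonObj_of_strongEpi`). Such quotients are subobjects of one fixed object, so up to
isomorphism they form a set; the image quotient of their coproduct is terminal
(`hasTerminal_costructuredArrow_forget`). The isomorphism with the co-opposite comes from uniqueness
in the universal property, and the adjunction on graphs is formed Hom-object by Hom-object. -/

/-! ### Limits, well-poweredness and images in locally presentable categories. -/

open Limits in
/-- A locally presentable category is complete: it is reflective in the category of presheaves on
a small dense subcategory. -/
theorem hasLimits_of_isLocallyPresentable (V : Type u) [Category.{v} V]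
    [IsLocallyPresentable.{v} V] : HasLimits V := by
  obtain ⟨κ, _, _⟩ := IsLocallyPresentable.exists_cardinal.{v} V
  let P := isCardinalPresentable V κ
  have : EssentiallySmall.{v} P.FullSubcategory := inferInstance
  let A : SmallModel.{v} P.FullSubcategory ⥤ V := (equivSmallModel _).inverse ⋙ P.ι
  have : A.IsDense := inferInstance
  let R := Presheaf.restrictedULiftYoneda.{v} A
  have : R.Full := inferInstance
  have : R.Faithful := inferInstance
  let L := uliftYoneda.{v}.leftKanExtension A
  have adj : L ⊣ R := Presheaf.uliftYonedaAdjunction L (uliftYoneda.{v}.leftKanExtensionUnit A)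
  have : Reflective R := { L := L, adj := adj }
  exact hasLimits_of_reflective R

theorem CategoryTheory.ObjectProperty.IsStrongGenerator.isDetecting {C : Type u} [Category.{v} C]
    {P : ObjectProperty C} (hP : P.IsStrongGenerator) : P.IsDetecting := by
  intro X Y f hf
  have : Mono f := ⟨fun {Z} g h hgh => hP.isSeparating _ _ fun G hG k =>
    (hf G hG (k ≫ g ≫ f)).unique (Category.assoc _ _ _) (by simp [hgh])⟩
  exact hP.isIso_of_mono f fun G hG k => (hf G hG k).exists

/-- A subobject is determined by which morphisms from a small detecting family factor through it. -/
theorem wellPowered_of_isLocallyPresentable (V : Type u) [Category.{v} V]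
    [IsLocallyPresentable.{v} V] : WellPowered.{v} V := by
  have := hasLimits_of_isLocallyPresentable V
  obtain ⟨κ, _, _⟩ := IsLocallyPresentable.exists_cardinal.{v} V
  obtain ⟨P, _, hP⟩ := HasCardinalFilteredGenerator.exists_small_generator V κ
  exact wellPowered_of_isDetecting hP.isStrongGenerator.isDetecting

open Limits in
/-- In a complete well-powered category, the intersection of all subobjects through which a
morphism factors is its image. -/
theorem hasImages_of_wellPowered (V : Type u) [Category.{v} V] [HasLimits V]
    [WellPowered.{v} V] : HasImages V where
  has_image {X Y} f := by
    let ι := Shrink.{v} {S : Subobject Y // S.Factors f}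
    let S : ι → Subobject Y := fun i => ((equivShrink _).symm i).1
    have hS : ∀ i, (S i).Factors f := fun i => ((equivShrink _).symm i).2
    let m : widePullback Y (fun i => (S i : V)) (fun i => (S i).arrow) ⟶ Y := WidePullback.base _
    have hm : Mono m := ⟨fun g h hgh => WidePullback.hom_ext _ _ _
      (fun i => by
        rw [← cancel_mono (S i).arrow]
        simpa [m] using hgh) hgh⟩
    refine HasImage.mk ⟨⟨_, m, WidePullback.lift f (fun i => (S i).factorThru f (hS i))
      (fun i => by simp), WidePullback.lift_base _ _ _ _⟩, ?_⟩
    have key (F : MonoFactorisation f) : ∃ i, S i = Subobject.mk F.m :=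
      ⟨equivShrink _ ⟨Subobject.mk F.m, (Subobject.mk_factors_iff _ _).2 ⟨F.e, F.fac⟩⟩,
        by simp [S]⟩
    choose k hk using key
    exact
      { lift := fun F => WidePullback.π _ (k F) ≫ Subobject.ofLE _ _ (hk F).le ≫
          (Subobject.underlyingIso F.m).hom
        lift_fac := fun F => by simp [m] }

/-- An adjunction induces an adjunction between the categories of graphs. -/
def VGraph.mapAdjunction {V : Type u} [Category.{v} V] {W : Type u'} [Category.{v'} W]
    {F : V ⥤ W} {G : W ⥤ V} (adj : F ⊣ G) :
    VGraph.mapFunctor.{w} F ⊣ VGraph.mapFunctor.{w} G :=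
  Adjunction.mkOfHomEquiv
    { homEquiv := fun A B =>
        { toFun := fun f => ⟨f.onObj, fun x y => adj.homEquiv _ _ (f.onHom x y)⟩
          invFun := fun f => ⟨f.onObj, fun x y => (adj.homEquiv _ _).symm (f.onHom x y)⟩
          left_inv := fun f => VGraph.Hom.ext rfl (heq_of_eq (by
            funext x y
            exact (adj.homEquiv _ _).symm_apply_apply _))
          right_inv := fun f => VGraph.Hom.ext rfl (heq_of_eq (by
            funext x y
            exact (adj.homEquiv _ _).apply_symm_apply _)) }
      homEquiv_naturality_left_symm := fun f g => VGraph.Hom.ext rfl (heq_of_eq (by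
        funext x y
        exact adj.homEquiv_naturality_left_symm _ _))
      homEquiv_naturality_right := fun f g => VGraph.Hom.ext rfl (heq_of_eq (by
        funext x y
        exact adj.homEquiv_naturality_right _ _)) }

/-! ### The involution on cofree coalgebras. -/

section Cop

variable {V : Type u} [Category.{v} V] [MonoidalCategory V]

theorem comon_hom_ext_of_adj {Tc : V ⥤ Comon V} (adj : Comon.forget V ⊣ Tc) {C : Comon V} {X : V}
    {f g : C ⟶ Tc.obj X}
    (h : f.hom ≫ adj.counit.app X = g.hom ≫ adj.counit.app X) : f = g :=
  (adj.homEquiv C X).symm.injective (by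
    rw [Adjunction.homEquiv_counit, Adjunction.homEquiv_counit]
    exact h)

/-- In a symmetric monoidal category, coalgebra morphisms `C^cop ⟶ D` are also coalgebra
morphisms `C ⟶ D^cop`. -/
def copTranspose [SymmetricCategory V] {C D : Comon V} (f : copObj C ⟶ D) : C ⟶ copObj D where
  hom := (f.hom : C.X ⟶ D.X)
  isComonHom_hom :=
    { hom_counit := IsComonHom.hom_counit f.hom
      hom_comul := by
        have h (a : C.X ⟶ D.X) (ha : a ≫ Δ[D.X] = (Δ[C.X] ≫ (β_ C.X C.X).hom) ≫ (a ⊗ₘ a)) :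
            a ≫ Δ[D.X] ≫ (β_ D.X D.X).hom = Δ[C.X] ≫ (a ⊗ₘ a) := by
          rw [reassoc_of% ha, BraidedCategory.braiding_naturality,
            SymmetricCategory.symmetry_assoc]
        exact h f.hom (IsComonHom.hom_comul f.hom) }

/-- The counit, read on the co-opposite, lifts to a unique coalgebra morphism `σ` over `X`. By
symmetry `σ` is also a morphism in the other direction, so `σ ≫ σ` is a coalgebra endomorphism of
`Tc X` over `X`, hence the identity. -/
theorem exists_involutive_iso_cop [SymmetricCategory V] (Tc : V ⥤ Comon V)
    (adj : Comon.forget V ⊣ Tc) :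
    ∃ t : Tc ≅ Tc ⋙ cop V, ∀ X : V, (t.hom.app X).hom ≫ (t.hom.app X).hom = 𝟙 (Tc.obj X).X := by
  let s (X : V) : copObj (Tc.obj X) ⟶ Tc.obj X :=
    adj.homEquiv (copObj (Tc.obj X)) X (adj.counit.app X)
  let σ (X : V) : (Tc.obj X).X ⟶ (Tc.obj X).X := (s X).hom
  let p (X : V) : (Tc.obj X).X ⟶ X := adj.counit.app X
  have hs (X : V) : σ X ≫ p X = p X :=
    (adj.homEquiv_counit _ _ (s X)).symm.trans ((adj.homEquiv _ _).symm_apply_apply _)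
  have hinv (X : V) : copTranspose (s X) ≫ s X = 𝟙 _ := by
    apply comon_hom_ext_of_adj adj
    change (σ X ≫ σ X) ≫ p X = 𝟙 _ ≫ p X
    rw [Category.assoc, hs, hs, Category.id_comp]
  have hinv' (X : V) : σ X ≫ σ X = 𝟙 _ :=
    congrArg Comon.Hom.hom (hinv X)
  refine ⟨NatIso.ofComponents (fun X =>
    { hom := copTranspose (s X)
      inv := s X
      hom_inv_id := hinv X
      inv_hom_id := Comon.Hom.ext (hinv' X) }) (fun {X Y} f => ?_), hinv'⟩
  -- Naturality is checked for the inverse `s`, whose target is cofree; `s` and its transpose share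
  -- the underlying morphism.
  have h : (cop V).map (Tc.map f) ≫ s Y = s X ≫ Tc.map f := by
    apply comon_hom_ext_of_adj adj
    have hn : (Tc.map f).hom ≫ p Y = p X ≫ f := adj.counit.naturality f
    change ((Tc.map f).hom ≫ σ Y) ≫ p Y = (σ X ≫ (Tc.map f).hom) ≫ p Y
    rw [Category.assoc, Category.assoc, hs, hn, reassoc_of% hs X]
  have h' : (Tc.map f).hom ≫ σ Y = σ X ≫ (Tc.map f).hom := congrArg Comon.Hom.hom h
  exact Comon.Hom.ext h'

end Cop

/-! ### Tensor powers and iterated comultiplication. -/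

namespace CofreeCoalgebra

variable {V : Type u} [Category.{v} V] [MonoidalCategory V]

/-- The iterated tensor powers of an object. -/
def tpow (X : V) : ℕ → V
  | 0 => 𝟙_ V
  | n + 1 => X ⊗ tpow X n

/-- Concatenation of tensor powers. -/
def tpowConcat (X : V) : ∀ n m : ℕ, tpow X n ⊗ tpow X m ≅ tpow X (m + n)
  -- The index `m + n` makes `m + 0 = m` and `m + (n + 1) = (m + n) + 1` definitional, so no
  -- transport is needed.
  | 0, m => λ_ (tpow X m)
  | n + 1, m => α_ X (tpow X n) (tpow X m) ≪≫ whiskerLeftIso X (tpowConcat X n m)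

/-- The morphism from a coalgebra `C` to the `n`-th tensor power of `X` induced by a morphism
`C ⟶ X` and the iterated comultiplication. -/
def toTpow {C X : V} [ComonObj C] (f : C ⟶ X) : ∀ n : ℕ, C ⟶ tpow X n
  | 0 => ε[C]
  | n + 1 => Δ[C] ≫ (f ⊗ₘ toTpow f n)

theorem comp_toTpow {C D X : V} [ComonObj C] [ComonObj D] (e : C ⟶ D) [IsComonHom e] (f : D ⟶ X)
    (n : ℕ) : e ≫ toTpow f n = toTpow (e ≫ f) n := by
  induction n with
  | zero => exact IsComonHom.hom_counit e
  | succ n ih =>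
    change e ≫ Δ[D] ≫ (f ⊗ₘ toTpow f n) = Δ[C] ≫ ((e ≫ f) ⊗ₘ toTpow (e ≫ f) n)
    rw [IsComonHom.hom_comul_assoc, tensorHom_comp_tensorHom, ih]

theorem comul_toTpow {C X : V} [ComonObj C] (f : C ⟶ X) (n m : ℕ) :
    Δ[C] ≫ (toTpow f n ⊗ₘ toTpow f m) ≫ (tpowConcat X n m).hom = toTpow f (m + n) := by
  induction n with
  | zero =>
    change Δ[C] ≫ (ε[C] ⊗ₘ toTpow f m) ≫ (λ_ (tpow X m)).hom = toTpow f m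
    simp
  | succ n ih =>
    change Δ[C] ≫ ((Δ[C] ≫ (f ⊗ₘ toTpow f n)) ⊗ₘ toTpow f m) ≫
      (α_ X (tpow X n) (tpow X m)).hom ≫ X ◁ (tpowConcat X n m).hom =
      Δ[C] ≫ (f ⊗ₘ toTpow f (m + n))
    have h : (Δ[C] ≫ (f ⊗ₘ toTpow f n)) ⊗ₘ toTpow f m =
        Δ[C] ▷ C ≫ ((f ⊗ₘ toTpow f n) ⊗ₘ toTpow f m) := by
      rw [← tensorHom_id, tensorHom_comp_tensorHom, Category.id_comp]
    rw [h, Category.assoc, associator_naturality_assoc, ← comul_assoc_assoc, ← ih,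
      ← id_tensorHom, ← id_tensorHom, tensorHom_comp_tensorHom, tensorHom_comp_tensorHom]
    simp

theorem comul_tensorHom_toTpow {C X : V} [ComonObj C] (f : C ⟶ X) (n m : ℕ) :
    Δ[C] ≫ (toTpow f n ⊗ₘ toTpow f m) = toTpow f (m + n) ≫ (tpowConcat X n m).inv := by
  rw [← comul_toTpow, Category.assoc, Category.assoc, Iso.hom_inv_id, Category.comp_id]

/-- The identification of the first tensor power of an object with the object itself. -/
def tpowOne (X : V) : tpow X 1 ⟶ X := (ρ_ X).hom

theorem toTpow_one {C X : V} [ComonObj C] (f : C ⟶ X) : toTpow f 1 ≫ tpowOne X = f := by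
  change (Δ[C] ≫ (f ⊗ₘ ε[C])) ≫ (ρ_ X).hom = f
  simp

/-- `d n ⊗ₘ d m` is `d n ▷ D` followed by `E n ◁ d m`, so flatness applies once on each side. -/
theorem jointlyMonic_tensor [VeryFlatTensor V] {D : V} {E : ℕ → V} {d : ∀ n, D ⟶ E n}
    (hd : JointlyMonic d) : JointlyMonic (fun p : ℕ × ℕ => d p.1 ⊗ₘ d p.2) := by
  have hd' : JointlyMonic (fun n : ULift.{v} ℕ => d n.down) :=
    fun Z f g h => hd f g fun n => h ⟨n⟩
  intro Z f g h
  refine VeryFlatTensor.whiskerRight D _ hd' f g fun n => ?_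
  refine VeryFlatTensor.whiskerLeft _ _ hd' _ _ fun m => ?_
  simpa [MonoidalCategory.tensorHom_def] using h (n.down, m.down)

/-- A morphism between coalgebras over `X` which is compatible with the morphisms to all tensor
powers of `X` is a coalgebra morphism if these morphisms are jointly monic on the target. -/
theorem isComonHom_of_toTpow [VeryFlatTensor V] {C D X : V} [ComonObj C] [ComonObj D]
    {f : C ⟶ X} {g : D ⟶ X} (hg : JointlyMonic (toTpow g)) (e : C ⟶ D)
    (he : ∀ n, e ≫ toTpow g n = toTpow f n) : IsComonHom e where
  -- The zeroth tensor power is the unit, and `toTpow g 0` is the counit.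
  hom_counit := he 0
  hom_comul := jointlyMonic_tensor hg _ _ fun ⟨n, m⟩ => by
    simp only [Category.assoc, tensorHom_comp_tensorHom, comul_tensorHom_toTpow, he, reassoc_of% he]

/-- A coalgebra structure descends along an epimorphism. -/
abbrev comonObjOfEpi {C D : V} [ComonObj C] (e : C ⟶ D) [Epi e] (c : D ⟶ 𝟙_ V) (δ : D ⟶ D ⊗ D)
    (hc : e ≫ c = ε[C]) (hδ : e ≫ δ = Δ[C] ≫ (e ⊗ₘ e)) : ComonObj D where
  counit := c
  comul := δ
  counit_comul := by
    rw [← cancel_epi e, reassoc_of% hδ, ← tensorHom_id, tensorHom_comp_tensorHom, hc,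
      Category.comp_id, counit_comul_hom]
  comul_counit := by
    rw [← cancel_epi e, reassoc_of% hδ, ← id_tensorHom, tensorHom_comp_tensorHom, hc,
      Category.comp_id, comul_counit_hom]
  comul_assoc := by
    rw [← cancel_epi e, reassoc_of% hδ, reassoc_of% hδ, ← id_tensorHom, ← tensorHom_id,
      tensorHom_comp_tensorHom, tensorHom_comp_tensorHom_assoc, hδ, Category.comp_id]
    have h₁ : e ⊗ₘ (Δ[C] ≫ (e ⊗ₘ e)) = C ◁ Δ[C] ≫ (e ⊗ₘ (e ⊗ₘ e)) := by
      rw [← id_tensorHom, tensorHom_comp_tensorHom, Category.id_comp]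
    have h₂ : (Δ[C] ≫ (e ⊗ₘ e)) ⊗ₘ e = Δ[C] ▷ C ≫ ((e ⊗ₘ e) ⊗ₘ e) := by
      rw [← tensorHom_id, tensorHom_comp_tensorHom, Category.id_comp]
    rw [h₁, h₂, comul_assoc_assoc, Category.assoc, associator_naturality]

/-! ### Quotients, coproducts and the terminal coalgebra over an object. -/

open Limits in
/-- A strongly epic quotient of a coalgebra `C` over `X` on which the morphisms to the tensor
powers of `X` are jointly monic is a coalgebra over `X`. -/
theorem exists_comonObj_of_strongEpi [VeryFlatTensor V] [HasCountableProducts V] {C D X : V}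
    [ComonObj C] (f : C ⟶ X) (e : C ⟶ D) [StrongEpi e] (d : ∀ n, D ⟶ tpow X n)
    (hd : JointlyMonic d) (hed : ∀ n, e ≫ d n = toTpow f n) :
    ∃ (_ : ComonObj D) (g : D ⟶ X), IsComonHom e ∧ e ≫ g = f ∧ toTpow g = d := by
  let m : D ⊗ D ⟶ ∏ᶜ fun p : ℕ × ℕ => tpow X p.1 ⊗ tpow X p.2 :=
    Pi.lift fun p => d p.1 ⊗ₘ d p.2
  have : Mono m := ⟨fun g h hgh => jointlyMonic_tensor hd g h fun p => by
    simpa [m] using congrArg (· ≫ Pi.π _ p) hgh⟩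
  let b : D ⟶ ∏ᶜ fun p : ℕ × ℕ => tpow X p.1 ⊗ tpow X p.2 :=
    Pi.lift fun p => d (p.2 + p.1) ≫ (tpowConcat X p.1 p.2).inv
  -- The strong epimorphism `e` lifts against the monomorphism `m`; the diagonal is the
  -- comultiplication of `D`.
  have sq : CommSq (Δ[C] ≫ (e ⊗ₘ e)) e m b := ⟨Pi.hom_ext _ _ fun p => by
    simp only [m, b, Category.assoc, Pi.lift_π, tensorHom_comp_tensorHom, hed, reassoc_of% hed,
      comul_tensorHom_toTpow]⟩
  let _ : ComonObj D := comonObjOfEpi e (d 0) sq.lift (hed 0) sq.fac_left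
  have he : IsComonHom e := ⟨hed 0, sq.fac_left⟩
  have heg : e ≫ d 1 ≫ tpowOne X = f := by
    rw [reassoc_of% hed 1, toTpow_one]
  refine ⟨inferInstance, d 1 ≫ tpowOne X, he, heg, funext fun n => ?_⟩
  rw [← cancel_epi e, comp_toTpow, heg, hed]

open Limits in
/-- Every coalgebra over `X` maps to one with jointly monic morphisms to the tensor powers. -/
theorem exists_jointlyMonic_quotient [VeryFlatTensor V] [HasCountableProducts V] [HasImages V]
    [HasStrongEpiImages V] (C : Comon V) {X : V} (f : C.X ⟶ X) :
    ∃ (D : Comon V) (e : C ⟶ D) (g : D.X ⟶ X), e.hom ≫ g = f ∧ JointlyMonic (toTpow g) := by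
  let F : C.X ⟶ ∏ᶜ tpow X := Pi.lift (toTpow f)
  let d (n : ℕ) : image F ⟶ tpow X n := image.ι F ≫ Pi.π _ n
  have hd : JointlyMonic d := fun Z g h hgh => by
    rw [← cancel_mono (image.ι F)]
    exact Pi.hom_ext _ _ fun n => by simpa [d] using hgh n
  obtain ⟨_, g, he, heg, hg⟩ := exists_comonObj_of_strongEpi f (factorThruImage F) d hd
    (fun n => by simp [d, F])
  exact ⟨⟨image F⟩, ⟨factorThruImage F⟩, g, heg, hg ▸ hd⟩

open Limits in
/-- The coproduct of a family of coalgebras. -/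
noncomputable abbrev comonSigma {ι : Type w} (D : ι → Comon V) [HasCoproduct fun i => (D i).X] :
    ComonObj (∐ fun i => (D i).X) where
  counit := Sigma.desc fun i => ε[(D i).X]
  comul := Sigma.desc fun i =>
    Δ[(D i).X] ≫ (Sigma.ι (fun i => (D i).X) i ⊗ₘ Sigma.ι (fun i => (D i).X) i)
  counit_comul := Sigma.hom_ext _ _ fun i => by
    rw [Sigma.ι_desc_assoc, Category.assoc, ← tensorHom_id, tensorHom_comp_tensorHom,
      Sigma.ι_desc, Category.comp_id, counit_comul_hom]
  comul_counit := Sigma.hom_ext _ _ fun i => by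
    rw [Sigma.ι_desc_assoc, Category.assoc, ← id_tensorHom, tensorHom_comp_tensorHom,
      Sigma.ι_desc, Category.comp_id, comul_counit_hom]
  comul_assoc := Sigma.hom_ext _ _ fun i => by
    rw [Sigma.ι_desc_assoc, Sigma.ι_desc_assoc, Category.assoc, Category.assoc, ← id_tensorHom,
      ← tensorHom_id, tensorHom_comp_tensorHom, tensorHom_comp_tensorHom_assoc, Sigma.ι_desc,
      Category.comp_id]
    generalize Sigma.ι (fun i => (D i).X) i = e
    have h₁ : e ⊗ₘ (Δ[(D i).X] ≫ (e ⊗ₘ e)) = (D i).X ◁ Δ[(D i).X] ≫ (e ⊗ₘ (e ⊗ₘ e)) := by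
      rw [← id_tensorHom, tensorHom_comp_tensorHom, Category.id_comp]
    have h₂ : (Δ[(D i).X] ≫ (e ⊗ₘ e)) ⊗ₘ e = Δ[(D i).X] ▷ (D i).X ≫ ((e ⊗ₘ e) ⊗ₘ e) := by
      rw [← tensorHom_id, tensorHom_comp_tensorHom, Category.id_comp]
    rw [h₁, h₂, comul_assoc_assoc, Category.assoc, associator_naturality]

open Limits in
/-- Every small family of coalgebras over `X` admits a common coalgebra over `X` to which all its
members map. -/
theorem exists_upper_bound {ι : Type w} (D : ι → Comon V) [HasCoproduct fun i => (D i).X] {X : V}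
    (g : ∀ i, (D i).X ⟶ X) :
    ∃ (S : Comon V) (a : ∀ i, D i ⟶ S) (h : S.X ⟶ X), ∀ i, (a i).hom ≫ h = g i := by
  let _ := comonSigma D
  have (i : ι) : IsComonHom (Sigma.ι (fun i => (D i).X) i) :=
    ⟨Sigma.ι_desc _ _, Sigma.ι_desc _ _⟩
  exact ⟨⟨∐ fun i => (D i).X⟩, fun i => ⟨Sigma.ι (fun i => (D i).X) i⟩, Sigma.desc g,
    fun i => Sigma.ι_desc _ _⟩

open Limits in
/-- The terminal coalgebra over `X`. -/
theorem hasTerminal_costructuredArrow_forget [VeryFlatTensor V] [HasCountableProducts V]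
    [HasImages V] [HasStrongEpiImages V] [HasCoproducts.{v} V] [WellPowered.{v} V] (X : V) :
    HasTerminal (CostructuredArrow (Comon.forget V) X) := by
  have hmono (D : Comon V) (g : D.X ⟶ X) (hg : JointlyMonic (toTpow g)) :
      Mono (Pi.lift (toTpow g)) := ⟨fun a b h => hg a b fun n => by
    simpa using congrArg (· ≫ Pi.π _ n) h⟩
  -- Well-poweredness makes this index set small; one coalgebra is chosen per subobject.
  let ι := Shrink.{v} {P : Subobject (∏ᶜ tpow X) // ∃ (D : Comon V) (g : D.X ⟶ X)
    (hg : JointlyMonic (toTpow g)), P = @Subobject.mk _ _ _ _ _ (hmono D g hg)}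
  have hι (i : ι) := ((equivShrink _).symm i).2
  choose D g hg hD using hι
  obtain ⟨S, a, h, ha⟩ := exists_upper_bound D g
  -- The coproduct is only weakly terminal; passing to the quotient restores joint monicity, which
  -- gives uniqueness.
  obtain ⟨T, q, t, hq, ht⟩ := exists_jointlyMonic_quotient S h
  have hex (C : Comon V) (f : C.X ⟶ X) : ∃ k : C ⟶ T, k.hom ≫ t = f := by
    obtain ⟨E, e, k, hk, hmk⟩ := exists_jointlyMonic_quotient C f
    have := hmono E k hmk
    let i : ι := equivShrink _ ⟨Subobject.mk (Pi.lift (toTpow k)), E, k, hmk, rfl⟩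
    have := hmono (D i) (g i) (hg i)
    have hi : Subobject.mk (Pi.lift (toTpow k)) = Subobject.mk (Pi.lift (toTpow (g i))) := by
      rw [← hD i]
      simp [i]
    let c : E.X ⟶ (D i).X := (Subobject.isoOfMkEqMk _ _ hi).hom
    have hcl : c ≫ Pi.lift (toTpow (g i)) = Pi.lift (toTpow k) := by simp [c]
    have hc (n : ℕ) : c ≫ toTpow (g i) n = toTpow k n := by
      simpa using congrArg (· ≫ Pi.π _ n) hcl
    -- Equality of subobjects suffices: commuting with the maps to tensor powers forces
    -- compatibility with the coalgebra structures.
    have : IsComonHom c := isComonHom_of_toTpow (hg i) c hc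
    have hcg : c ≫ g i = k := by
      rw [← toTpow_one (g i), reassoc_of% hc 1, toTpow_one]
    exact ⟨e ≫ ⟨c⟩ ≫ a i ≫ q, by simp [hq, ha, hcg, hk]⟩
  have huniq (C : Comon V) (k l : C ⟶ T) (hkl : k.hom ≫ t = l.hom ≫ t) : k = l :=
    Comon.Hom.ext (ht _ _ fun n => by rw [comp_toTpow, comp_toTpow, hkl])
  choose k hk using hex
  exact IsTerminal.hasTerminal (X := CostructuredArrow.mk (S := Comon.forget V) (Y := T) t)
    (IsTerminal.ofUniqueHom (fun A => CostructuredArrow.homMk (k A.left A.hom) (hk _ _))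
      fun A m => by
        ext1
        exact huniq _ _ _ ((CostructuredArrow.w m).trans (hk _ _).symm))

end CofreeCoalgebra

theorem isLeftAdjoint_comon_forget (V : Type u) [Category.{v} V] [MonoidalCategory V]
    [IsLocallyPresentable.{v} V] [VeryFlatTensor V] : (Comon.forget V).IsLeftAdjoint := by
  have := hasLimits_of_isLocallyPresentable V
  have := wellPowered_of_isLocallyPresentable V
  have := hasImages_of_wellPowered V
  have : Limits.HasLimitsOfSize.{0, 0} V := Limits.hasLimitsOfSizeShrink.{0, 0, v, v} V
  have : Limits.HasCountableProducts V := ⟨fun J _ => inferInstance⟩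
  have : Limits.HasCoproducts.{v} V := by
    obtain ⟨κ, _, _⟩ := IsLocallyPresentable.exists_cardinal.{v} V
    infer_instance
  -- Images are strong epi images here, since pullbacks and equalizers exist.
  have := CofreeCoalgebra.hasTerminal_costructuredArrow_forget (V := V)
  exact isLeftAdjoint_of_costructuredArrowTerminals _

theorem corollary2p6 (V : Type u) [Category.{v} V] [MonoidalCategory V] [MonoidalClosed V]
    [IsLocallyPresentable.{v} V] [VeryFlatTensor V] :
    -- the cofree coalgebra functor `Tc` exists
    (Comon.forget V).IsLeftAdjoint ∧
    -- an involutive natural isomorphism of coalgebras `Tc X ≅ (Tc X)^cop`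
    (∀ [SymmetricCategory V] (Tc : V ⥤ Comon V) (_ : Comon.forget V ⊣ Tc),
      ∃ t : Tc ≅ Tc ⋙ cop V,
        ∀ X : V, (t.hom.app X).hom ≫ (t.hom.app X).hom = 𝟙 (Tc.obj X).X) ∧
    -- the forgetful functor from `Coalg(V)`-graphs to `V`-graphs has a right adjoint
    (VGraph.mapFunctor.{w} (Comon.forget V)).IsLeftAdjoint := by
  have h := isLeftAdjoint_comon_forget V
  exact ⟨h, fun Tc adj => exists_involutive_iso_cop Tc adj,
    (VGraph.mapAdjunction (Adjunction.ofIsLeftAdjoint (Comon.forget V))).isLeftAdjoint⟩
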